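/- Let $M\ge 0$ be an integer and let $\mathsf{x}$ be a random variable on a probability space with values in $\mathbb{R}^M$ (Borel $\sigma$-algebra), with law $\mu_{\mathsf{x}}$. Let $\mathscr{H}^m$ be the $m$-dimensional Hausdorff measure, normalized as usual so that $\mathscr{H}^m$ is Lebesgue measure $\mathscr{L}^m$ on $\mathbb{R}^m$ (and $\mathscr{H}^0$ is counting measure). **Definitions.** A set $\mathcal{E}\subseteq\mathbb{R}^M$ is *$0$-rectifiable* if it is finite or countably infinite; for $1\le m\le M$ it is *$m$-rectifiable* if it is $\mathscr{H}^m$-measurable and there are bounded $\mathscr{L}^m$-measurable sets $\mathcal{A}_k\subseteq\mathbb{R}^m$ and Lipschitz functions $f_k\colon\mathcal{A}_k\to\mathbb{R}^M$, $k\in\mathbb{N}$, with $\mathscr{H}^m\bigl(\mathcal{E}\setminus\bigcup_k f_k(\mathcal{A}_k)\bigr)=0$. The random variable $\mathsf{x}$ is *$m$-rectifiable* if $\mu_{\mathsf{x}}\ll\mathscr{H}^m|_{\mathcal{E}}$ for some $m$-rectifiable set $\mathcal{E}$. Its *$m$-dimensional Hausdorff density* is then $\theta^m_{\mathsf{x}}=\frac{\mathrm{d}\mu_{\mathsf{x}}}{\mathrm{d}\mathscr{H}^m|_{\mathcal{E}}}$,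 taken to be $0$ outside $\mathcal{E}$. Its *$m$-dimensional entropy* is $\mathfrak{h}^m(\mathsf{x})=-\int_{\mathbb{R}^M}\log\theta^m_{\mathsf{x}}\,\mathrm{d}\mu_{\mathsf{x}}$, provided the integral exists in $\mathbb{R}\cup\{\pm\infty\}$. The set $\mathcal{E}$ is a *support* of $\mathsf{x}$ if it is $m$-rectifiable, $\mu_{\mathsf{x}}\ll\mathscr{H}^m|_{\mathcal{E}}$, $\theta^m_{\mathsf{x}}>0$ $\mathscr{H}^m|_{\mathcal{E}}$-almost everywhere, and $\mathcal{E}=\bigcup_{k\in\mathbb{N}}f_k(\mathcal{A}_k)$ with bounded Borel sets $\mathcal{A}_k\subseteq\mathbb{R}^m$ and Lipschitz functions $f_k\colon\mathbb{R}^m\to\mathbb{R}^M$ that are one-to-one on $\mathcal{A}_k$. **Theorem.** 1. $\mathsf{x}$ is $0$-rectifiable if and only if it is discrete, i.e., there is a finite or countably infinite set $\mathcal{S}=\{\boldsymbol{x}_i:i\in\mathcal{I}\}$ with $\Pr\{\mathsf{x}=\boldsymbol{x}_i\}>0$ for all $i\in\mathcal I$ and $\Pr\{\mathsf{x}\in\mathcal{S}\}=1$.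 In this case, for every $0$-rectifiable $\mathcal{E}$ with $\mu_{\mathsf{x}}\ll\mathscr{H}^0|_{\mathcal{E}}$, $\theta^0_{\mathsf{x}}(\boldsymbol{x})=\Pr\{\mathsf{x}=\boldsymbol{x}\}$ for all $\boldsymbol{x}\in\mathbb{R}^M$; the set $\mathcal{S}$ is a support of $\mathsf{x}$; and the $0$-dimensional entropy exists in $[0,\infty]$, does not depend on $\mathcal{E}$, and equals Shannon entropy, $$\mathfrak{h}^0(\mathsf{x})=H(\mathsf{x})=-\sum_{i\in\mathcal{I}}\Pr\{\mathsf{x}=\boldsymbol{x}_i\}\log\Pr\{\mathsf{x}=\boldsymbol{x}_i\}.$$ 2. $\mathsf{x}$ is $M$-rectifiable if and only if it is continuous, i.e., there is a measurable $f_{\mathsf{x}}\colon\mathbb{R}^M\to[0,\infty)$ with $\Pr\{\mathsf{x}\in\mathcal{A}\}=\int_{\mathcal{A}}f_{\mathsf{x}}\,\mathrm{d}\mathscr{L}^M$ for all Borel sets $\mathcal{A}$. In this case, for every $M$-rectifiable $\mathcal{E}$ with $\mu_{\mathsf{x}}\ll\mathscr{H}^M|_{\mathcal{E}}$, $\theta^M_{\mathsf{x}}=f_{\mathsf{x}}$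 $\mathscr{L}^M$-almost everywhere; and the $M$-dimensional entropy, which does not depend on $\mathcal{E}$, coincides with differential entropy, $$\mathfrak{h}^M(\mathsf{x})=h(\mathsf{x})=-\int_{\mathbb{R}^M}f_{\mathsf{x}}\log f_{\mathsf{x}}\,\mathrm{d}\mathscr{L}^M,$$ in the sense that one of the two exists in $\mathbb{R}\cup\{\pm\infty\}$ if and only if the other does, and then they are equal. -/

import Mathlib

open MeasureTheory
open scoped ENNReal NNReal

noncomputable section

/-- `m`-rectifiable subsets of `ℝ^M`. For `m = 0` these are the finite or countably infinite sets.
For `1 ≤ m ≤ M` they are the `ℋ^m`-measurable sets that are covered, up to an `ℋ^m`-null set, by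
countably many Lipschitz images of bounded Lebesgue measurable subsets of `ℝ^m`.
Here `μHE[m]` is the `m`-dimensional Hausdorff measure in its usual geometric normalization, which
is Lebesgue measure on `ℝ^m` (and counting measure for `m = 0`). -/
def IsRectifiableSet (m : ℕ) {M : ℕ} (E : Set (EuclideanSpace ℝ (Fin M))) : Prop :=
  (m = 0 ∧ E.Countable) ∨
  (0 < m ∧ m ≤ M ∧ NullMeasurableSet E (μHE[m] : Measure (EuclideanSpace ℝ (Fin M))) ∧
    ∃ (A : ℕ → Set (EuclideanSpace ℝ (Fin m)))
      (f : ℕ → EuclideanSpace ℝ (Fin m) → EuclideanSpace ℝ (Fin M)),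
      (∀ k, NullMeasurableSet (A k) volume ∧ Bornology.IsBounded (A k) ∧
        ∃ K : ℝ≥0, LipschitzOnWith K (f k) (A k)) ∧
      (μHE[m] : Measure (EuclideanSpace ℝ (Fin M))) (E \ ⋃ k, f k '' A k) = 0)

/-- `E` is an `m`-rectifiable set with `μ ≪ ℋ^m|_E`. -/
def IsRectifiableCarrier (m : ℕ) {M : ℕ} (μ : Measure (EuclideanSpace ℝ (Fin M)))
    (E : Set (EuclideanSpace ℝ (Fin M))) : Prop :=
  IsRectifiableSet m E ∧ μ ≪ (μHE[m] : Measure (EuclideanSpace ℝ (Fin M))).restrict E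

/-- `m`-rectifiable Borel measures on `ℝ^M`. -/
def IsRectifiableMeasure (m : ℕ) {M : ℕ} (μ : Measure (EuclideanSpace ℝ (Fin M))) : Prop :=
  ∃ E : Set (EuclideanSpace ℝ (Fin M)), IsRectifiableCarrier m μ E

/-- The `m`-dimensional Hausdorff density `dμ / d(ℋ^m|_E)`. The Radon-Nikodym derivative is only
determined up to `ℋ^m|_E`-null sets; this is the version that vanishes outside `E`. -/
def hausdorffDensity (m : ℕ) {M : ℕ} (μ : Measure (EuclideanSpace ℝ (Fin M)))
    (E : Set (EuclideanSpace ℝ (Fin M))) : EuclideanSpace ℝ (Fin M) → ℝ≥0∞ :=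
  E.indicator (μ.rnDeriv ((μHE[m] : Measure (EuclideanSpace ℝ (Fin M))).restrict E))

/-- `E` is a support of the `m`-rectifiable measure `μ`. -/
def IsRectifiableSupport (m : ℕ) {M : ℕ} (μ : Measure (EuclideanSpace ℝ (Fin M)))
    (E : Set (EuclideanSpace ℝ (Fin M))) : Prop :=
  IsRectifiableCarrier m μ E ∧
  (∀ᵐ x ∂((μHE[m] : Measure (EuclideanSpace ℝ (Fin M))).restrict E),
    0 < hausdorffDensity m μ E x) ∧
  ∃ (A : ℕ → Set (EuclideanSpace ℝ (Fin m)))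
    (f : ℕ → EuclideanSpace ℝ (Fin m) → EuclideanSpace ℝ (Fin M)),
    (∀ k, MeasurableSet (A k) ∧ Bornology.IsBounded (A k) ∧
      (∃ K : ℝ≥0, LipschitzWith K (f k)) ∧ Set.InjOn (f k) (A k)) ∧
    E = ⋃ k, f k '' A k

/-- `∫ g dμ` exists in `ℝ ∪ {±∞}` and equals `I`: the positive part and the negative part of `g`
do not both have infinite integral, and `I` is the difference of their integrals. -/
def HasExtendedIntegral {α : Type*} [MeasurableSpace α] (μ : Measure α) (g : α → EReal)
    (I : EReal) : Prop :=
  AEMeasurable g μ ∧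
  (∫⁻ x, (g x).toENNReal ∂μ ≠ ∞ ∨ ∫⁻ x, (-g x).toENNReal ∂μ ≠ ∞) ∧
  I = ((∫⁻ x, (g x).toENNReal ∂μ : ℝ≥0∞) : EReal)
    - ((∫⁻ x, (-g x).toENNReal ∂μ : ℝ≥0∞) : EReal)

section RandomVariables

variable {Ω : Type*} [MeasurableSpace Ω] {M : ℕ}

/-- `m`-rectifiable random variables. -/
def IsRectifiableRV (m : ℕ) (X : Ω → EuclideanSpace ℝ (Fin M)) (P : Measure Ω) : Prop :=
  IsRectifiableMeasure m (P.map X)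

/-- The `m`-dimensional entropy `- ∫ log θ d(law of X)` of the `m`-rectifiable random variable `X`
exists in `ℝ ∪ {±∞}` and equals `h`, where `θ` is the `m`-dimensional Hausdorff density, formed
with respect to any `m`-rectifiable set `E` such that the law is absolutely continuous with
respect to `ℋ^m|_E`. -/
def HasRectifiableEntropy (m : ℕ) (X : Ω → EuclideanSpace ℝ (Fin M)) (P : Measure Ω)
    (h : EReal) : Prop :=
  IsRectifiableRV m X P ∧
  ∀ E : Set (EuclideanSpace ℝ (Fin M)), IsRectifiableCarrier m (P.map X) E →
    HasExtendedIntegral (P.map X) (fun x => -(hausdorffDensity m (P.map X) E x).log) h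

/-- `S` is the finite or countably infinite set of realizations of `X`: each of its points is
attained with positive probability, and `X` takes values in `S` with probability one. -/
def IsRealizationSet (X : Ω → EuclideanSpace ℝ (Fin M)) (P : Measure Ω)
    (S : Set (EuclideanSpace ℝ (Fin M))) : Prop :=
  S.Countable ∧ (∀ x ∈ S, 0 < P (X ⁻¹' {x})) ∧ P (X ⁻¹' S) = 1

/-- Discrete random variables. -/
def IsDiscreteRV (X : Ω → EuclideanSpace ℝ (Fin M)) (P : Measure Ω) : Prop :=
  ∃ S : Set (EuclideanSpace ℝ (Fin M)), IsRealizationSet X P S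

/-- Shannon entropy `- ∑ p(x) log p(x)` in `[0, ∞]`, with natural logarithm, where
`p(x) = P(X = x)` and the sum is over the points `x` with `p(x) > 0`. -/
def shannonEntropy (X : Ω → EuclideanSpace ℝ (Fin M)) (P : Measure Ω) : ℝ≥0∞ :=
  ∑' x : {x : EuclideanSpace ℝ (Fin M) // 0 < P (X ⁻¹' {x})},
    ENNReal.ofReal (-((P (X ⁻¹' {x.1})).toReal * Real.log (P (X ⁻¹' {x.1})).toReal))

/-- `f` is a probability density function of `X`. -/
def IsProbabilityDensity (X : Ω → EuclideanSpace ℝ (Fin M)) (P : Measure Ω)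
    (f : EuclideanSpace ℝ (Fin M) → ℝ) : Prop :=
  AEMeasurable f volume ∧ (∀ x, 0 ≤ f x) ∧
  ∀ A : Set (EuclideanSpace ℝ (Fin M)), MeasurableSet A →
    P (X ⁻¹' A) = ∫⁻ x in A, ENNReal.ofReal (f x)

/-- Continuous random variables. -/
def IsContinuousRV (X : Ω → EuclideanSpace ℝ (Fin M)) (P : Measure Ω) : Prop :=
  ∃ f : EuclideanSpace ℝ (Fin M) → ℝ, IsProbabilityDensity X P f

/-- The differential entropy `- ∫ f log f dx` of `X`, where `f` is a probability density function
of `X`, exists in `ℝ ∪ {±∞}` and equals `h`. -/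
def HasDifferentialEntropy (X : Ω → EuclideanSpace ℝ (Fin M)) (P : Measure Ω)
    (h : EReal) : Prop :=
  ∃ f : EuclideanSpace ℝ (Fin M) → ℝ, IsProbabilityDensity X P f ∧
    HasExtendedIntegral volume (fun x => ((-(f x * Real.log (f x)) : ℝ) : EReal)) h

end RandomVariables

end

/-! In both extreme dimensions `μHE[m]` is a familiar measure, so the density is computed outright
and the choice of `E` drops out. For `m = 0` it is counting measure. A carrier is then just a
countable set of full mass, and the density at a point is the mass of that point
(`hausdorffDensity_zero_apply`). Integrating `-log` of it over the atoms gives the Shannon sum; all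
terms are nonnegative, so existence is automatic. For `m = M` it is Lebesgue measure. Extended by
zero, the density on any carrier is a density of the law with respect to `volume`, hence a.e. equal
to any probability density. Integrals against the law become integrals weighted by `f`, separately
for the positive and negative parts, so existence transfers along with the value
(`hasExtendedIntegral_volume_iff`). -/

namespace RectifiableEntropy

variable {Ω : Type*} [MeasurableSpace Ω] {M : ℕ}

/-! ### Dimension zero -/

section ZeroDimensional

variable {μ : Measure (EuclideanSpace ℝ (Fin M))} {E : Set (EuclideanSpace ℝ (Fin M))}

theorem isRectifiableSet_zero_iff : IsRectifiableSet 0 E ↔ E.Countable := by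
  simp [IsRectifiableSet]

theorem euclideanHausdorffMeasure_zero_singleton (x : EuclideanSpace ℝ (Fin M)) :
    (μHE[0] : Measure (EuclideanSpace ℝ (Fin M))) {x} = 1 := by
  rw [Measure.euclideanHausdorffMeasure_zero, Measure.hausdorffMeasure_zero_singleton]

/-- Only the empty set is `ℋ^0`-null, so the null sets of the restriction are those disjoint from
`E`. -/
theorem absolutelyContinuous_restrict_zero_iff (hE : E.Countable) :
    μ ≪ (μHE[0] : Measure (EuclideanSpace ℝ (Fin M))).restrict E ↔ μ Eᶜ = 0 := by
  refine ⟨fun h => h (by simp [Measure.restrict_apply hE.measurableSet.compl]), fun h =>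
    Measure.AbsolutelyContinuous.mk fun A hA h0 => ?_⟩
  rw [Measure.restrict_apply hA, Measure.euclideanHausdorffMeasure_zero] at h0
  have hempty : A ∩ E = ∅ := by
    by_contra hne
    have := Measure.one_le_hausdorffMeasure_zero_of_nonempty (Set.nonempty_iff_ne_empty.2 hne)
    simp [h0] at this
  exact measure_mono_null (fun x hx hxE => (hempty ▸ ⟨hx, hxE⟩ : x ∈ (∅ : Set _))) h

theorem isRectifiableCarrier_zero_iff :
    IsRectifiableCarrier 0 μ E ↔ E.Countable ∧ μ Eᶜ = 0 := by
  rw [IsRectifiableCarrier, isRectifiableSet_zero_iff]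
  exact and_congr_right absolutelyContinuous_restrict_zero_iff

/-- Supplies the Lebesgue decomposition behind the Radon-Nikodym identity; `ℋ^0` itself is not
σ-finite on an uncountable space. -/
theorem sigmaFinite_restrict_zero (hE : E.Countable) :
    SigmaFinite ((μHE[0] : Measure (EuclideanSpace ℝ (Fin M))).restrict E) := by
  refine Measure.sigmaFinite_of_countable (S := insert Eᶜ ((fun x => {x}) '' E))
    ((hE.image _).insert _) ?_ ?_
  · rintro s (rfl | ⟨x, -, rfl⟩)
    · simp [Measure.restrict_apply hE.measurableSet.compl]
    · refine (Measure.restrict_apply_le _ _).trans_lt ?_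
      simp
  · refine Set.eq_univ_of_forall fun x => ?_
    by_cases hx : x ∈ E
    · exact ⟨{x}, Or.inr ⟨x, hx, rfl⟩, rfl⟩
    · exact ⟨Eᶜ, Or.inl rfl, hx⟩

/-- Evaluate the Radon-Nikodym identity on `{x}`, which has `ℋ^0`-mass 1. Off `E` both sides vanish,
so equality is pointwise everywhere. -/
theorem hausdorffDensity_zero_apply [IsFiniteMeasure μ] (h : IsRectifiableCarrier 0 μ E)
    (x : EuclideanSpace ℝ (Fin M)) : hausdorffDensity 0 μ E x = μ {x} := by
  obtain ⟨hE, h0⟩ := isRectifiableCarrier_zero_iff.1 h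
  by_cases hx : x ∈ E
  · have := sigmaFinite_restrict_zero hE
    rw [hausdorffDensity, Set.indicator_of_mem hx]
    conv_rhs => rw [← Measure.withDensity_rnDeriv_eq _ _ h.2]
    rw [withDensity_apply _ (measurableSet_singleton x), lintegral_singleton,
      Measure.restrict_eq_self _ (Set.singleton_subset_iff.2 hx),
      euclideanHausdorffMeasure_zero_singleton, mul_one]
  · rw [hausdorffDensity, Set.indicator_of_notMem hx]
    exact (measure_mono_null (Set.singleton_subset_iff.2 hx) h0).symm

theorem measurable_hausdorffDensity_zero (hE : E.Countable) :
    Measurable (hausdorffDensity 0 μ E) :=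
  (Measure.measurable_rnDeriv _ _).indicator hE.measurableSet

theorem exists_lipschitz_cover_of_countable (hE : E.Countable) :
    ∃ (A : ℕ → Set (EuclideanSpace ℝ (Fin 0)))
      (f : ℕ → EuclideanSpace ℝ (Fin 0) → EuclideanSpace ℝ (Fin M)),
      (∀ k, MeasurableSet (A k) ∧ Bornology.IsBounded (A k) ∧
        (∃ K : ℝ≥0, LipschitzWith K (f k)) ∧ Set.InjOn (f k) (A k)) ∧
      E = ⋃ k, f k '' A k := by
  rcases E.eq_empty_or_nonempty with rfl | hne
  · exact ⟨fun _ => ∅, fun _ _ => 0, fun _ => ⟨.empty, Bornology.isBounded_empty,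
      ⟨0, LipschitzWith.const 0⟩, Set.injOn_empty _⟩, by simp⟩
  · obtain ⟨g, rfl⟩ := hE.exists_eq_range hne
    -- `ℝ^0` is a single point, so constant maps are injective on it.
    refine ⟨fun _ => Set.univ, fun k _ => g k, fun k => ⟨.univ, Set.finite_univ.isBounded,
      ⟨0, LipschitzWith.const _⟩, Set.injOn_of_subsingleton _ _⟩, ?_⟩
    ext x
    simp

end ZeroDimensional

/-! ### Discrete laws and Shannon entropy -/

section Discrete

variable {P : Measure Ω} {X : Ω → EuclideanSpace ℝ (Fin M)}
  {E S : Set (EuclideanSpace ℝ (Fin M))}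

theorem map_singleton (hX : Measurable X) (x : EuclideanSpace ℝ (Fin M)) :
    P.map X {x} = P (X ⁻¹' {x}) :=
  Measure.map_apply hX (measurableSet_singleton x)

theorem IsRealizationSet.isRectifiableCarrier [IsProbabilityMeasure P] (hX : Measurable X)
    (hS : IsRealizationSet X P S) : IsRectifiableCarrier 0 (P.map X) S := by
  have hm := hS.1.measurableSet
  refine isRectifiableCarrier_zero_iff.2 ⟨hS.1, ?_⟩
  rw [Measure.map_apply hX hm.compl, Set.preimage_compl, prob_compl_eq_zero_iff (hX hm)]
  exact hS.2.2

/-- All atoms lie in `E`. What remains is `Eᶜ` together with countably many non-atoms of `E`, hence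
null. -/
theorem isRealizationSet_of_isRectifiableCarrier [IsProbabilityMeasure P] (hX : Measurable X)
    (h : IsRectifiableCarrier 0 (P.map X) E) :
    IsRealizationSet X P {x | 0 < P (X ⁻¹' {x})} := by
  obtain ⟨hE, h0⟩ := isRectifiableCarrier_zero_iff.1 h
  have hsub : {x | 0 < P (X ⁻¹' {x})} ⊆ E := by
    intro x hx
    by_contra hxE
    rw [Set.mem_ofPred_eq, ← map_singleton hX,
      measure_mono_null (Set.singleton_subset_iff.2 hxE) h0] at hx
    exact hx.false
  have hc := hE.mono hsub
  refine ⟨hc, fun x hx => hx, ?_⟩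
  rw [← prob_compl_eq_zero_iff (hX hc.measurableSet), ← Set.preimage_compl,
    ← Measure.map_apply hX hc.measurableSet.compl]
  refine measure_mono_null (t := Eᶜ ∪ ⋃ x ∈ E \ {x | 0 < P (X ⁻¹' {x})}, {x}) ?_
    (measure_union_null h0 ((measure_biUnion_null_iff (hE.mono Set.sdiff_subset)).2 ?_))
  · intro x hx
    by_cases hxE : x ∈ E
    · exact Or.inr (Set.mem_biUnion ⟨hxE, hx⟩ rfl)
    · exact Or.inl hxE
  · intro x hx
    rw [map_singleton hX]
    exact nonpos_iff_eq_zero.1 (not_lt.1 hx.2)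

theorem isRectifiableRV_zero_iff_isDiscreteRV [IsProbabilityMeasure P] (hX : Measurable X) :
    IsRectifiableRV 0 X P ↔ IsDiscreteRV X P :=
  ⟨fun ⟨_, hE⟩ => ⟨_, isRealizationSet_of_isRectifiableCarrier hX hE⟩,
    fun ⟨S, hS⟩ => ⟨S, IsRealizationSet.isRectifiableCarrier hX hS⟩⟩

theorem IsRealizationSet.isRectifiableSupport [IsProbabilityMeasure P] (hX : Measurable X)
    (hS : IsRealizationSet X P S) : IsRectifiableSupport 0 (P.map X) S := by
  have hc := IsRealizationSet.isRectifiableCarrier hX hS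
  have := Measure.isProbabilityMeasure_map (μ := P) hX.aemeasurable
  refine ⟨hc, ae_restrict_of_forall_mem hS.1.measurableSet fun x hx => ?_,
    exists_lipschitz_cover_of_countable hS.1⟩
  rw [hausdorffDensity_zero_apply hc, map_singleton hX]
  exact hS.2.1 x hx

theorem ennreal_log_eq_coe_log_toReal {p : ℝ≥0∞} (h0 : p ≠ 0) (h1 : p ≠ ∞) :
    p.log = (Real.log p.toReal : EReal) := by
  rw [ENNReal.log_pos_real h0 h1]

theorem lintegral_neg_log_map_singleton [IsProbabilityMeasure P] (hX : Measurable X)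
    (h : IsRectifiableCarrier 0 (P.map X) E) :
    ∫⁻ x, (-(P.map X {x}).log).toENNReal ∂(P.map X) = shannonEntropy X P := by
  have hD := isRealizationSet_of_isRectifiableCarrier hX h
  have h0 := (isRectifiableCarrier_zero_iff.1 (IsRealizationSet.isRectifiableCarrier hX hD)).2
  have hae : {x | 0 < P (X ⁻¹' {x})} =ᵐ[P.map X] Set.univ := Filter.eventuallyEq_univ.2 h0
  rw [← setLIntegral_univ, ← setLIntegral_congr hae,
    lintegral_countable _ hD.1]
  refine tsum_congr fun x => ?_
  have hx : P (X ⁻¹' {x.1}) ≠ 0 := x.2.ne'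
  have ht : P (X ⁻¹' {x.1}) ≠ ∞ := measure_ne_top _ _
  rw [map_singleton hX, ennreal_log_eq_coe_log_toReal hx ht, ← EReal.coe_neg,
    EReal.real_coe_toENNReal, mul_comm, ← mul_neg, ENNReal.ofReal_mul ENNReal.toReal_nonneg,
    ENNReal.ofReal_toReal ht]

theorem hasExtendedIntegral_zero_iff [IsProbabilityMeasure P] (hX : Measurable X)
    (hE : IsRectifiableCarrier 0 (P.map X) E) (h : EReal) :
    HasExtendedIntegral (P.map X) (fun x => -(hausdorffDensity 0 (P.map X) E x).log) h ↔
      h = (shannonEntropy X P : EReal) := by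
  have := Measure.isProbabilityMeasure_map (μ := P) hX.aemeasurable
  have hmeas : AEMeasurable (fun x => -(hausdorffDensity 0 (P.map X) E x).log) (P.map X) :=
    (measurable_hausdorffDensity_zero (isRectifiableCarrier_zero_iff.1 hE).1).ennreal_log.neg
      |>.aemeasurable
  -- Point masses are at most 1, so `-log` has no negative part and the extended integral exists.
  have hneg : ∫⁻ x, (- -(P.map X {x}).log).toENNReal ∂(P.map X) = 0 := by
    rw [lintegral_congr (g := fun _ => 0), lintegral_zero]
    intro x
    rw [neg_neg, EReal.toENNReal_of_nonpos]
    exact ENNReal.log_le_zero_iff.2 prob_le_one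
  have hpos := lintegral_neg_log_map_singleton hX hE
  rw [HasExtendedIntegral, and_iff_right hmeas]
  simp only [hausdorffDensity_zero_apply hE, hpos, hneg]
  simp

theorem hasRectifiableEntropy_zero_iff [IsProbabilityMeasure P] (hX : Measurable X)
    (hR : IsRectifiableRV 0 X P) (h : EReal) :
    HasRectifiableEntropy 0 X P h ↔ h = (shannonEntropy X P : EReal) := by
  obtain ⟨E, hE⟩ := hR
  exact ⟨fun H => (hasExtendedIntegral_zero_iff hX hE h).1 (H.2 E hE),
    fun H => ⟨⟨E, hE⟩, fun F hF => (hasExtendedIntegral_zero_iff hX hF h).2 H⟩⟩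

end Discrete

/-! ### Full dimension -/

section FullDimension

variable {E : Set (EuclideanSpace ℝ (Fin M))}

theorem IsRectifiableSet.nullMeasurableSet {m : ℕ} (h : IsRectifiableSet m E) :
    NullMeasurableSet E (μHE[m] : Measure (EuclideanSpace ℝ (Fin M))) := by
  rcases h with ⟨-, h⟩ | ⟨-, -, h, -⟩
  · exact h.measurableSet.nullMeasurableSet
  · exact h

theorem isRectifiableSet_univ (M : ℕ) :
    IsRectifiableSet M (Set.univ : Set (EuclideanSpace ℝ (Fin M))) := by
  rcases Nat.eq_zero_or_pos M with rfl | hM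
  · exact Or.inl ⟨rfl, Set.countable_univ⟩
  · refine Or.inr ⟨hM, le_rfl, nullMeasurableSet_univ, fun k => Metric.ball 0 k, fun _ => id,
      fun k => ⟨measurableSet_ball.nullMeasurableSet, Metric.isBounded_ball, 1,
        LipschitzWith.id.lipschitzOnWith⟩, ?_⟩
    simp [Metric.iUnion_ball_nat]

/-- Replace `s` by its a.e. equal measurable hull. Needed because rectifiable sets are only
`ℋ^m`-measurable. -/
theorem withDensity_indicator₀ {α : Type*} [MeasurableSpace α] {μ : Measure α} {s : Set α}
    (hs : NullMeasurableSet s μ) (f : α → ℝ≥0∞) :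
    μ.withDensity (s.indicator f) = (μ.restrict s).withDensity f := by
  rw [← Measure.restrict_congr_set hs.toMeasurable_ae_eq,
    ← withDensity_indicator (measurableSet_toMeasurable μ s)]
  exact withDensity_congr_ae (indicator_ae_eq_of_ae_eq_set hs.toMeasurable_ae_eq).symm

theorem aemeasurable_hausdorffDensity_volume {μ : Measure (EuclideanSpace ℝ (Fin M))}
    (hE : IsRectifiableSet M E) : AEMeasurable (hausdorffDensity M μ E) volume := by
  have hm := IsRectifiableSet.nullMeasurableSet hE
  rw [EuclideanSpace.euclideanHausdorffMeasure_eq_volume] at hm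
  exact (Measure.measurable_rnDeriv _ _).aemeasurable.indicator₀ hm

theorem withDensity_hausdorffDensity_volume {μ : Measure (EuclideanSpace ℝ (Fin M))}
    [IsFiniteMeasure μ] (hE : IsRectifiableCarrier M μ E) :
    volume.withDensity (hausdorffDensity M μ E) = μ := by
  have hm := IsRectifiableSet.nullMeasurableSet hE.1
  have hac := hE.2
  rw [EuclideanSpace.euclideanHausdorffMeasure_eq_volume] at hm hac
  rw [hausdorffDensity, EuclideanSpace.euclideanHausdorffMeasure_eq_volume,
    withDensity_indicator₀ hm, Measure.withDensity_rnDeriv_eq _ _ hac]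

variable {P : Measure Ω} {X : Ω → EuclideanSpace ℝ (Fin M)} {f : EuclideanSpace ℝ (Fin M) → ℝ}

theorem IsProbabilityDensity.map_eq_withDensity (hX : Measurable X)
    (hf : IsProbabilityDensity X P f) :
    P.map X = volume.withDensity fun x => ENNReal.ofReal (f x) := by
  ext A hA
  rw [Measure.map_apply hX hA, withDensity_apply _ hA, hf.2.2 A hA]

theorem hausdorffDensity_volume_ae_eq [IsProbabilityMeasure P] (hX : Measurable X)
    (hE : IsRectifiableCarrier M (P.map X) E) (hf : IsProbabilityDensity X P f) :
    hausdorffDensity M (P.map X) E =ᵐ[volume] fun x => ENNReal.ofReal (f x) := by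
  have := Measure.isProbabilityMeasure_map (μ := P) hX.aemeasurable
  rw [← withDensity_eq_iff_of_sigmaFinite (aemeasurable_hausdorffDensity_volume hE.1)
    hf.1.ennreal_ofReal, withDensity_hausdorffDensity_volume hE]
  exact IsProbabilityDensity.map_eq_withDensity hX hf

theorem isProbabilityDensity_hausdorffDensity [IsProbabilityMeasure P] (hX : Measurable X)
    (hE : IsRectifiableCarrier M (P.map X) E) :
    IsProbabilityDensity X P fun x => (hausdorffDensity M (P.map X) E x).toReal := by
  have := Measure.isProbabilityMeasure_map (μ := P) hX.aemeasurable
  have hm := aemeasurable_hausdorffDensity_volume (μ := P.map X) hE.1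
  have hd := withDensity_hausdorffDensity_volume hE
  refine ⟨hm.ennreal_toReal, fun _ => ENNReal.toReal_nonneg, fun A hA => ?_⟩
  -- The density has finite integral, so passing to real values loses nothing a.e.
  have hfin : ∀ᵐ x, hausdorffDensity M (P.map X) E x < ∞ := by
    refine ae_lt_top' hm ?_
    rw [← setLIntegral_univ, ← withDensity_apply _ .univ, hd]
    exact measure_ne_top _ _
  rw [← Measure.map_apply hX hA]
  conv_lhs => rw [← hd, withDensity_apply _ hA]
  refine lintegral_congr_ae (ae_restrict_of_ae (hfin.mono fun x hx => ?_))
  exact (ENNReal.ofReal_toReal hx.ne).symm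

theorem IsProbabilityDensity.isRectifiableCarrier_univ (hX : Measurable X)
    (hf : IsProbabilityDensity X P f) : IsRectifiableCarrier M (P.map X) Set.univ := by
  refine ⟨isRectifiableSet_univ M, ?_⟩
  rw [Measure.restrict_univ, EuclideanSpace.euclideanHausdorffMeasure_eq_volume,
    IsProbabilityDensity.map_eq_withDensity hX hf]
  exact withDensity_absolutelyContinuous _ _

theorem isRectifiableRV_iff_isContinuousRV [IsProbabilityMeasure P] (hX : Measurable X) :
    IsRectifiableRV M X P ↔ IsContinuousRV X P :=
  ⟨fun ⟨_, hE⟩ => ⟨_, isProbabilityDensity_hausdorffDensity hX hE⟩,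
    fun ⟨_, hf⟩ => ⟨_, IsProbabilityDensity.isRectifiableCarrier_univ hX hf⟩⟩

/-- At `t = 0` the left side is `0 * ∞ = 0`, which agrees with the convention `0 * Real.log 0 = 0`.
-/
theorem ofReal_mul_toENNReal_neg_log {t : ℝ} (ht : 0 ≤ t) :
    ENNReal.ofReal t * (-(ENNReal.ofReal t).log).toENNReal =
      ((-(t * Real.log t) : ℝ) : EReal).toENNReal := by
  rcases ht.eq_or_lt with rfl | ht
  · simp
  · rw [ENNReal.log_ofReal_of_pos ht, ← EReal.coe_neg, EReal.real_coe_toENNReal,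
      EReal.real_coe_toENNReal, ← ENNReal.ofReal_mul ht.le, mul_neg]

theorem ofReal_mul_toENNReal_log {t : ℝ} (ht : 0 ≤ t) :
    ENNReal.ofReal t * (- -(ENNReal.ofReal t).log).toENNReal =
      (-((-(t * Real.log t) : ℝ) : EReal)).toENNReal := by
  rcases ht.eq_or_lt with rfl | ht
  · simp
  · rw [ENNReal.log_ofReal_of_pos ht, neg_neg, ← EReal.coe_neg, EReal.real_coe_toENNReal,
      EReal.real_coe_toENNReal, ← ENNReal.ofReal_mul ht.le, neg_neg]

theorem hasExtendedIntegral_volume_iff [IsProbabilityMeasure P] (hX : Measurable X)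
    (hE : IsRectifiableCarrier M (P.map X) E) (hf : IsProbabilityDensity X P f) (h : EReal) :
    HasExtendedIntegral (P.map X) (fun x => -(hausdorffDensity M (P.map X) E x).log) h ↔
      HasExtendedIntegral volume (fun x => ((-(f x * Real.log (f x)) : ℝ) : EReal)) h := by
  have hμ := IsProbabilityDensity.map_eq_withDensity hX hf
  have hF : AEMeasurable (fun x => ENNReal.ofReal (f x)) volume := hf.1.ennreal_ofReal
  have hac : P.map X ≪ volume := hμ ▸ withDensity_absolutelyContinuous _ _
  have hθ := hac.ae_eq (hausdorffDensity_volume_ae_eq hX hE hf)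
  have hlog : AEMeasurable (fun x => -(ENNReal.ofReal (f x)).log) volume :=
    (ENNReal.measurable_log.comp_aemeasurable hF).neg
  have hm₁ : AEMeasurable (fun x => -(hausdorffDensity M (P.map X) E x).log) (P.map X) :=
    (ENNReal.measurable_log.comp_aemeasurable
      ((aemeasurable_hausdorffDensity_volume hE.1).mono_ac hac)).neg
  have hm₂ : AEMeasurable (fun x => ((-(f x * Real.log (f x)) : ℝ) : EReal)) volume :=
    (hf.1.mul (Real.measurable_log.comp_aemeasurable hf.1)).neg.coe_real_ereal
  have hpos : ∫⁻ x, (-(hausdorffDensity M (P.map X) E x).log).toENNReal ∂(P.map X) =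
      ∫⁻ x, ((-(f x * Real.log (f x)) : ℝ) : EReal).toENNReal := by
    rw [lintegral_congr_ae (hθ.mono fun x hx =>
        congrArg (fun t : ℝ≥0∞ => (-t.log).toENNReal) hx), hμ,
      lintegral_withDensity_eq_lintegral_mul₀ hF hlog.ereal_toENNReal]
    exact lintegral_congr fun x => ofReal_mul_toENNReal_neg_log (hf.2.1 x)
  have hneg : ∫⁻ x, (- -(hausdorffDensity M (P.map X) E x).log).toENNReal ∂(P.map X) =
      ∫⁻ x, (-((-(f x * Real.log (f x)) : ℝ) : EReal)).toENNReal := by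
    rw [lintegral_congr_ae (hθ.mono fun x hx =>
        congrArg (fun t : ℝ≥0∞ => (- -t.log).toENNReal) hx), hμ,
      lintegral_withDensity_eq_lintegral_mul₀ hF
        (show AEMeasurable (fun x => (- -(ENNReal.ofReal (f x)).log).toENNReal) volume from
          hlog.neg.ereal_toENNReal)]
    exact lintegral_congr fun x => ofReal_mul_toENNReal_log (hf.2.1 x)
  unfold HasExtendedIntegral
  rw [hpos, hneg]
  simp only [hm₁, hm₂, true_and]

theorem hasRectifiableEntropy_iff_hasDifferentialEntropy [IsProbabilityMeasure P]
    (hX : Measurable X) (hR : IsRectifiableRV M X P) (h : EReal) :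
    HasRectifiableEntropy M X P h ↔ HasDifferentialEntropy X P h := by
  constructor
  · rintro ⟨⟨E, hE⟩, H⟩
    have hf := isProbabilityDensity_hausdorffDensity hX hE
    exact ⟨_, hf, (hasExtendedIntegral_volume_iff hX hE hf h).1 (H E hE)⟩
  · rintro ⟨f, hf, H⟩
    -- The comparison holds for every pair of carrier and density, so one `f` settles all `E`.
    exact ⟨hR, fun E hE => (hasExtendedIntegral_volume_iff hX hE hf h).2 H⟩

end FullDimension

end RectifiableEntropy


theorem mainTheorem2 {Ω : Type*} [MeasurableSpace Ω] (P : Measure Ω) [IsProbabilityMeasure P]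
    {M : ℕ} (X : Ω → EuclideanSpace ℝ (Fin M)) (hX : Measurable X) :
    -- dimension zero
    ((IsRectifiableRV 0 X P ↔ IsDiscreteRV X P) ∧
      (∀ E : Set (EuclideanSpace ℝ (Fin M)), IsRectifiableCarrier 0 (P.map X) E →
        ∀ x, hausdorffDensity 0 (P.map X) E x = P (X ⁻¹' {x})) ∧
      (∀ S : Set (EuclideanSpace ℝ (Fin M)), IsRealizationSet X P S →
        IsRectifiableSupport 0 (P.map X) S) ∧
      (IsRectifiableRV 0 X P →
        ∀ h : EReal, HasRectifiableEntropy 0 X P h ↔ h = (shannonEntropy X P : EReal))) ∧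
    -- full dimension
    ((IsRectifiableRV M X P ↔ IsContinuousRV X P) ∧
      (∀ E : Set (EuclideanSpace ℝ (Fin M)), IsRectifiableCarrier M (P.map X) E →
        ∀ f : EuclideanSpace ℝ (Fin M) → ℝ, IsProbabilityDensity X P f →
          hausdorffDensity M (P.map X) E =ᵐ[volume] fun x => ENNReal.ofReal (f x)) ∧
      (IsRectifiableRV M X P →
        ∀ h : EReal, HasRectifiableEntropy M X P h ↔ HasDifferentialEntropy X P h)) := by
  refine ⟨⟨RectifiableEntropy.isRectifiableRV_zero_iff_isDiscreteRV hX, fun E hE x => ?_,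
    fun S hS => RectifiableEntropy.IsRealizationSet.isRectifiableSupport hX hS,
    fun hR h => RectifiableEntropy.hasRectifiableEntropy_zero_iff hX hR h⟩,
    RectifiableEntropy.isRectifiableRV_iff_isContinuousRV hX,
    fun E hE f hf => RectifiableEntropy.hausdorffDensity_volume_ae_eq hX hE hf,
    fun hR h => RectifiableEntropy.hasRectifiableEntropy_iff_hasDifferentialEntropy hX hR h⟩
  have := Measure.isProbabilityMeasure_map (μ := P) hX.aemeasurable
  rw [RectifiableEntropy.hausdorffDensity_zero_apply hE, RectifiableEntropy.map_singleton hX]
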